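/- Let $(j_i)_{i\ge 1}$ be positive integers, put $N=j_1$, and let $G_0=[0,1]$ (one edge, two vertices, horizontal coordinate $x$). Let $G_{n}$ be obtained from $G_{n-1}$ by dividing each edge into $j_{n}$ equal subintervals, taking two copies of the resulting graph, and identifying each new node (each subdivision point interior to an edge of $G_{n-1}$) with the corresponding new node of the other copy; the coordinate $x$ is inherited. (These are the quantum graph approximations of the Laakso space of the sequence $(j_i)$; the $j=N$ Laakso space is the case $j_i=N$ for all $i$.) Let $a\ge 1$ and $Z\ge 0$ be integers with $2a+Z+1=N$, and let $X_0\in(0,1/2)$. Two conducting plates are attached symmetrically at the nodes of $G_1$ with $x=a/N$ and $x=1-a/N$, so that $Z$ nodes of $G_1$ lie strictly between them, and are then moved to distance $X_0$ from the centre. That is, for $n\ge1$ let $F_n$ be the metric graph $G_n$ with its coordinate changed by the increasing piecewise linear bijection of $[0,1]$ that is affine on $[0,a/N]$, $[a/N,1-a/N]$, $[1-a/N,1]$ and sends $0,\ a/N,\ 1-a/N,\ 1$ to $0,\ 1/2-X_0,\ 1/2+X_0,\ 1$; and let $F_0$ be $[0,1]$ with vertices $0,\ 1/2-X_0,\ 1/2+X_0,\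 1$. Each edge of $F_n$ is an interval parametrized by arc length, which is the coordinate $x$. The conducting nodes of $F_n$ are its vertices with $x=1/2\pm X_0$. For $n\ge 0$ let $L^2(F_n)=\bigoplus_e L^2(e)$ (complex valued functions, Lebesgue measure on each edge $e$), and let $B_n$ be the operator in $L^2(F_n)$ that acts as $B_nf=-\frac{d^2f}{dx_e^2}$ on each edge $e$, with domain $$\operatorname{Dom}(B_n)=\{f \text{ continuous on } F_n:\ f\in H^2(e)\ \forall e,\ f(v)=0 \text{ at each conducting node } v,\ \textstyle\sum_{e\ni v} f_e'(v)=0 \text{ at each other vertex } v\},$$ where $f_e'(v)$ is the derivative at $v$ along $e$ in the direction away from $v$. **Theorem.** For each $n\ge 0$, $B_n$ is densely defined and self-adjoint in $L^2(F_n)$. -/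

import Mathlib

open MeasureTheory Set
open scoped ContDiff

noncomputable section

/-! ## Finite metric graphs with a horizontal coordinate -/

/-- A finite metric graph (multiple edges allowed) drawn with a horizontal coordinate `x`.
The edge `e` is the interval `[x (src e), x (tgt e)]`, with `x` as its arc length parameter, so its
length is `x (tgt e) - x (src e)`. -/
structure QuantumGraph where
  /-- vertices -/
  V : Type
  /-- edges -/
  E : Type
  [fintypeV : Fintype V]
  [fintypeE : Fintype E]
  /-- left endpoint of an edge -/
  src : E → V
  /-- right endpoint of an edge -/
  tgt : E → V
  /-- horizontal coordinate of a vertex -/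
  x : V → ℝ
  x_lt : ∀ e, x (src e) < x (tgt e)

attribute [instance] QuantumGraph.fintypeV QuantumGraph.fintypeE

namespace QuantumGraph

/-- The unit interval `[0,1]`: two vertices and one edge. -/
def unitInterval : QuantumGraph where
  V := Fin 2
  E := Unit
  src := fun _ => 0
  tgt := fun _ => 1
  x := ![0, 1]
  x_lt := fun _ => by simp

section SubdivideDouble

variable (G : QuantumGraph) (k : ℕ)

/-- Vertices after each edge is cut into `k` equal parts, the graph is duplicated, and each new node
is identified with its counterpart in the other copy: two copies of each old vertex, and one node
`(e, m)`, `0 < m < k`, for each interior cutting point of each edge. -/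
abbrev SubV : Type := (G.V × Bool) ⊕ (G.E × (Finset.Ioo 0 k : Finset ℕ))

/-- The `m`-th cutting point (`0 ≤ m ≤ k`) of the edge `e` in the copy `b`; for `0 < m < k` it does
not depend on `b`. -/
def cutNode (e : G.E) (b : Bool) (m : ℕ) : G.SubV k :=
  if h : m ∈ Finset.Ioo 0 k then .inr (e, ⟨m, h⟩)
  else if m = 0 then .inl (G.src e, b) else .inl (G.tgt e, b)

/-- Horizontal coordinate of the vertices of the subdivided and doubled graph. -/
def subX : G.SubV k → ℝ
  | .inl v => G.x v.1
  | .inr p => G.x (G.src p.1) + (p.2 : ℕ) / k * (G.x (G.tgt p.1) - G.x (G.src p.1))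

theorem subX_cutNode (e : G.E) (b : Bool) (m : ℕ) (hk : 0 < k) (hm : m ≤ k) :
    G.subX k (G.cutNode k e b m)
      = G.x (G.src e) + (m : ℝ) / k * (G.x (G.tgt e) - G.x (G.src e)) := by
  have hk' : (k : ℝ) ≠ 0 := by positivity
  unfold cutNode
  split_ifs with h h0
  · rfl
  · subst h0; simp [subX]
  · have : m = k := by
      rw [Finset.mem_Ioo] at h
      omega
    subst this
    simp [subX, div_self hk']

/-- Divide each edge into `k` equal subintervals, duplicate the graph, and glue each new node to the
corresponding new node of the other copy. -/
def subdivideDouble : QuantumGraph where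
  V := G.SubV k
  E := G.E × Fin k × Bool
  src := fun p => G.cutNode k p.1 p.2.2 p.2.1
  tgt := fun p => G.cutNode k p.1 p.2.2 (p.2.1 + 1)
  x := G.subX k
  x_lt := by
    rintro ⟨e, i, b⟩
    have hk : 0 < k := i.pos
    have hk' : (0 : ℝ) < k := by exact_mod_cast hk
    rw [G.subX_cutNode k e b _ hk i.2.le, G.subX_cutNode k e b _ hk i.2]
    have h := sub_pos.2 (G.x_lt e)
    have h2 : ((i : ℕ) : ℝ) / k < (((i : ℕ) + 1 : ℕ) : ℝ) / k := by
      gcongr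
      omega
    have := mul_lt_mul_of_pos_right h2 h
    linarith

end SubdivideDouble

/-- Stretch and compress a graph by moving the vertices with an increasing change `φ` of the
horizontal coordinate. -/
def distort (G : QuantumGraph) (φ : ℝ → ℝ) (hφ : StrictMono φ) : QuantumGraph where
  V := G.V
  E := G.E
  src := G.src
  tgt := G.tgt
  x := fun v => φ (G.x v)
  x_lt := fun e => hφ (G.x_lt e)

end QuantumGraph

/-- The undistorted quantum graphs of the Laakso space of the sequence `j 1, j 2, …`. -/
def laaksoGraph (j : ℕ → ℕ) : ℕ → QuantumGraph
  | 0 => QuantumGraph.unitInterval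
  | n + 1 => (laaksoGraph j n).subdivideDouble (j (n + 1))

/-! ## Two conducting plates in a Laakso space -/

/-- A Laakso space with two conducting plates: the numbers `j i` of subdivisions, the number `Z` of
nodes of the first graph strictly between the plates, and the distance `X₀` of each plate to the
centre. The plates are attached to the interior nodes of the first graph in the columns `a` and
`j 1 - a`. -/
structure PlateConfiguration where
  j : ℕ → ℕ
  j_pos : ∀ i, 1 ≤ i → 1 ≤ j i
  a : ℕ
  Z : ℕ
  one_le_a : 1 ≤ a
  columns : 2 * a + Z + 1 = j 1
  X₀ : ℝ
  X₀_pos : 0 < X₀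
  X₀_lt : X₀ < 1 / 2

namespace PlateConfiguration

variable (C : PlateConfiguration)

/-- Original coordinate `a / j 1` of the left plate. -/
def p : ℝ := (C.a : ℝ) / (C.j 1 : ℝ)

theorem p_pos : 0 < C.p := by
  have h1 : (0 : ℝ) < C.a := by exact_mod_cast C.one_le_a
  have h2 : (0 : ℝ) < C.j 1 := by
    have := C.columns
    exact_mod_cast (by omega : 0 < C.j 1)
  exact div_pos h1 h2

theorem p_lt : C.p < 1 / 2 := by
  have h3 := C.columns
  have h2 : (0 : ℝ) < C.j 1 := by exact_mod_cast (by omega : 0 < C.j 1)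
  have h4 : (2 * C.a : ℝ) < C.j 1 := by exact_mod_cast (by omega : 2 * C.a < C.j 1)
  rw [p, div_lt_iff₀ h2]
  linarith

/-- The piecewise linear change of coordinate which moves the plates from `p` and `1 - p` to
`1/2 - X₀` and `1/2 + X₀`, and stretches or compresses each of the three regions uniformly. -/
def move (t : ℝ) : ℝ :=
  if t ≤ C.p then (1 / 2 - C.X₀) / C.p * t
  else if t ≤ 1 - C.p then 1 / 2 + C.X₀ / (1 / 2 - C.p) * (t - 1 / 2)
  else 1 - (1 / 2 - C.X₀) / C.p * (1 - t)

theorem move_strictMono : StrictMono C.move := by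
  have hp := C.p_pos
  have hq : 0 < 1 / 2 - C.p := by linarith [C.p_lt]
  obtain ⟨s, hs⟩ : ∃ s, s = (1 / 2 - C.X₀) / C.p := ⟨_, rfl⟩
  obtain ⟨r, hr⟩ : ∃ r, r = C.X₀ / (1 / 2 - C.p) := ⟨_, rfl⟩
  have hs0 : 0 < s := hs ▸ div_pos (by linarith [C.X₀_lt]) hp
  have hr0 : 0 < r := hr ▸ div_pos C.X₀_pos hq
  have hsp : s * C.p = 1 / 2 - C.X₀ := by rw [hs]; field_simp
  have hrq : r * (1 / 2 - C.p) = C.X₀ := by rw [hr]; exact div_mul_cancel₀ _ hq.ne'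
  intro t u htu
  simp only [move, ← hs, ← hr]
  split_ifs <;> nlinarith

/-- The interval `[0,1]` with the two plates as additional vertices. -/
def baseGraph : QuantumGraph where
  V := Fin 4
  E := Fin 3
  src := ![0, 1, 2]
  tgt := ![1, 2, 3]
  x := ![0, 1 / 2 - C.X₀, 1 / 2 + C.X₀, 1]
  x_lt := by
    have h1 := C.X₀_pos
    have h2 := C.X₀_lt
    intro e
    fin_cases e
    · change (0 : ℝ) < 1 / 2 - C.X₀
      linarith
    · change 1 / 2 - C.X₀ < 1 / 2 + C.X₀
      linarith
    · change 1 / 2 + C.X₀ < 1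
      linarith

/-- The quantum graph `F_n` of the configuration. -/
def F : ℕ → QuantumGraph
  | 0 => C.baseGraph
  | n + 1 => (laaksoGraph C.j (n + 1)).distort C.move C.move_strictMono

/-- The conducting nodes of `F_n`: the nodes that lie on one of the two plates. -/
def conducting (n : ℕ) : Set (C.F n).V :=
  {v | (C.F n).x v = 1 / 2 - C.X₀ ∨ (C.F n).x v = 1 / 2 + C.X₀}

end PlateConfiguration

/-! ## Weak derivatives on an interval -/

/-- `L²(a, b)`, complex valued. -/
abbrev IntervalL2 (a b : ℝ) : Type := Lp ℂ 2 (volume.restrict (Ioo a b))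

/-- `g` is the weak derivative of `f` on `(a, b)`. -/
def HasWeakDeriv {a b : ℝ} (f g : IntervalL2 a b) : Prop :=
  ∀ φ : ℝ → ℝ, ContDiff ℝ ∞ φ → HasCompactSupport φ → tsupport φ ⊆ Ioo a b →
    ∫ x in Ioo a b, deriv φ x • f x = -∫ x in Ioo a b, φ x • g x

/-- `u` is, on `[a, b]`, the continuous representative of the class `f`. -/
def IsContRep {a b : ℝ} (f : IntervalL2 a b) (u : ℝ → ℂ) : Prop :=
  ContinuousOn u (Icc a b) ∧ f =ᵐ[volume.restrict (Ioo a b)] u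

section WeakDerivLemmas

variable {a b : ℝ}

theorem integrable_smul_intervalL2 (f : IntervalL2 a b) {φ : ℝ → ℝ} (hφ : Continuous φ)
    (hc : HasCompactSupport φ) :
    Integrable (fun x => φ x • f x) (volume.restrict (Ioo a b)) := by
  have hf : Integrable f (volume.restrict (Ioo a b)) := (Lp.memLp f).integrable (by norm_num)
  obtain ⟨M, hM⟩ := hc.exists_bound_of_continuous hφ
  exact hf.bdd_smul M hφ.aestronglyMeasurable (Filter.Eventually.of_forall hM)

theorem HasWeakDeriv.zero : HasWeakDeriv (0 : IntervalL2 a b) 0 := by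
  intro φ _ _ _
  have h : ∀ ψ : ℝ → ℝ, ∫ x in Ioo a b, ψ x • (0 : IntervalL2 a b) x = 0 := by
    intro ψ
    rw [← integral_zero ℝ ℂ (μ := volume.restrict (Ioo a b))]
    apply integral_congr_ae
    filter_upwards [Lp.coeFn_zero ℂ 2 (volume.restrict (Ioo a b))] with x hx
    rw [hx, Pi.zero_apply, smul_zero]
  rw [h, h, neg_zero]

theorem HasWeakDeriv.add {f g f' g' : IntervalL2 a b} (hf : HasWeakDeriv f f')
    (hg : HasWeakDeriv g g') : HasWeakDeriv (f + g) (f' + g') := by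
  intro φ h1 h2 h3
  have key : ∀ (ψ : ℝ → ℝ), Continuous ψ → HasCompactSupport ψ → ∀ u v : IntervalL2 a b,
      ∫ x in Ioo a b, ψ x • (u + v) x
        = (∫ x in Ioo a b, ψ x • u x) + ∫ x in Ioo a b, ψ x • v x := by
    intro ψ hψ hψc u v
    rw [← integral_add (integrable_smul_intervalL2 u hψ hψc) (integrable_smul_intervalL2 v hψ hψc)]
    apply integral_congr_ae
    filter_upwards [Lp.coeFn_add u v] with x hx
    rw [hx, Pi.add_apply, smul_add]
  rw [key _ (h1.continuous_deriv (by simp)) h2.deriv, key _ h1.continuous h2,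
    hf φ h1 h2 h3, hg φ h1 h2 h3]
  ring

theorem HasWeakDeriv.smul {f f' : IntervalL2 a b} (c : ℂ) (hf : HasWeakDeriv f f') :
    HasWeakDeriv (c • f) (c • f') := by
  intro φ h1 h2 h3
  have key : ∀ (ψ : ℝ → ℝ) (u : IntervalL2 a b),
      ∫ x in Ioo a b, ψ x • (c • u) x = c * ∫ x in Ioo a b, ψ x • u x := by
    intro ψ u
    rw [← integral_const_mul]
    apply integral_congr_ae
    filter_upwards [Lp.coeFn_smul c u] with x hx
    rw [hx, Pi.smul_apply, smul_eq_mul, mul_smul_comm]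
  rw [key, key, hf φ h1 h2 h3]
  ring

theorem HasWeakDeriv.unique {f g g' : IntervalL2 a b} (h : HasWeakDeriv f g)
    (h' : HasWeakDeriv f g') : g = g' := by
  have hi : ∀ u : IntervalL2 a b, IntegrableOn u (Ioo a b) volume :=
    fun u => (Lp.memLp u).integrable (by norm_num)
  have h0 : ∀ᵐ x ∂volume, x ∈ Ioo a b → (g x - g' x) = 0 := by
    refine isOpen_Ioo.ae_eq_zero_of_integral_contDiff_smul_eq_zero
      ((hi g).sub (hi g')).locallyIntegrableOn ?_
    intro φ h1 h2 h3
    have hz : ∀ x, x ∉ Ioo a b → φ x • (g x - g' x) = 0 := by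
      intro x hx
      rw [image_eq_zero_of_notMem_tsupport (fun hx' => hx (h3 hx')), zero_smul]
    rw [← setIntegral_eq_integral_of_forall_compl_eq_zero hz]
    simp only [smul_sub]
    rw [integral_sub (integrable_smul_intervalL2 g h1.continuous h2)
      (integrable_smul_intervalL2 g' h1.continuous h2)]
    have e1 := h φ h1 h2 h3
    have e2 := h' φ h1 h2 h3
    rw [e1] at e2
    rw [neg_injective e2, sub_self]
  apply Lp.ext
  filter_upwards [(ae_restrict_iff' measurableSet_Ioo).2 h0] with x hx
  exact sub_eq_zero.1 hx

theorem IsContRep.zero : IsContRep (0 : IntervalL2 a b) (fun _ => 0) :=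
  ⟨continuousOn_const, Lp.coeFn_zero ℂ 2 _⟩

theorem IsContRep.add {f g : IntervalL2 a b} {u v : ℝ → ℂ} (hf : IsContRep f u)
    (hg : IsContRep g v) : IsContRep (f + g) (fun x => u x + v x) :=
  ⟨hf.1.add hg.1, (Lp.coeFn_add f g).trans (hf.2.add hg.2)⟩

theorem IsContRep.smul {f : IntervalL2 a b} {u : ℝ → ℂ} (c : ℂ) (hf : IsContRep f u) :
    IsContRep (c • f) (fun x => c * u x) :=
  ⟨continuousOn_const.mul hf.1, (Lp.coeFn_smul c f).trans (hf.2.const_smul c)⟩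

end WeakDerivLemmas

/-! ## The operator `-d²/dx²` with Dirichlet and Kirchhoff vertex conditions -/

namespace QuantumGraph

variable (G : QuantumGraph) (D : Set G.V)

/-- The Hilbert space `L²(G) = ⨁ₑ L²(e)` of complex valued functions. -/
abbrev L2 : Type := PiLp 2 (fun e : G.E => IntervalL2 (G.x (G.src e)) (G.x (G.tgt e)))

/-- `f` lies in `H²(e)` for each edge `e`, with first and second weak derivatives `f₁`, `f₂` in
`L²(e)`; `u`, `u₁` are the continuous representatives of `f`, `f₁` on the closed edges; `f` is
continuous on `G` (with vertex values `c`), satisfies the Dirichlet condition at the vertices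
in `D`, and the Kirchhoff condition (the outgoing derivatives sum to `0`) at all other vertices. -/
structure DomainData (f f₁ f₂ : G.L2) (u u₁ : G.E → ℝ → ℂ) (c : G.V → ℂ) : Prop where
  weak_one : ∀ e, HasWeakDeriv (f e) (f₁ e)
  weak_two : ∀ e, HasWeakDeriv (f₁ e) (f₂ e)
  rep : ∀ e, IsContRep (f e) (u e)
  rep_one : ∀ e, IsContRep (f₁ e) (u₁ e)
  cont_src : ∀ e, u e (G.x (G.src e)) = c (G.src e)
  cont_tgt : ∀ e, u e (G.x (G.tgt e)) = c (G.tgt e)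
  dirichlet : ∀ v ∈ D, c v = 0
  kirchhoff : ∀ v ∉ D, open Classical in
    (∑ e with G.src e = v, u₁ e (G.x v)) - (∑ e with G.tgt e = v, u₁ e (G.x v)) = 0

variable {G D} in
theorem DomainData.add {f f₁ f₂ g g₁ g₂ : G.L2} {u u₁ w w₁ : G.E → ℝ → ℂ} {c d : G.V → ℂ}
    (hf : G.DomainData D f f₁ f₂ u u₁ c) (hg : G.DomainData D g g₁ g₂ w w₁ d) :
    G.DomainData D (f + g) (f₁ + g₁) (f₂ + g₂) (fun e x => u e x + w e x)
      (fun e x => u₁ e x + w₁ e x) (fun v => c v + d v) where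
  weak_one e := (hf.weak_one e).add (hg.weak_one e)
  weak_two e := (hf.weak_two e).add (hg.weak_two e)
  rep e := (hf.rep e).add (hg.rep e)
  rep_one e := (hf.rep_one e).add (hg.rep_one e)
  cont_src e := by rw [hf.cont_src, hg.cont_src]
  cont_tgt e := by rw [hf.cont_tgt, hg.cont_tgt]
  dirichlet v hv := by rw [hf.dirichlet v hv, hg.dirichlet v hv, add_zero]
  kirchhoff v hv := by
    have h1 := hf.kirchhoff v hv
    have h2 := hg.kirchhoff v hv
    simp only [Finset.sum_add_distrib]
    linear_combination h1 + h2

variable {G D} in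
theorem DomainData.smul {f f₁ f₂ : G.L2} {u u₁ : G.E → ℝ → ℂ} {c : G.V → ℂ} (z : ℂ)
    (hf : G.DomainData D f f₁ f₂ u u₁ c) :
    G.DomainData D (z • f) (z • f₁) (z • f₂) (fun e x => z * u e x)
      (fun e x => z * u₁ e x) (fun v => z * c v) where
  weak_one e := (hf.weak_one e).smul z
  weak_two e := (hf.weak_two e).smul z
  rep e := (hf.rep e).smul z
  rep_one e := (hf.rep_one e).smul z
  cont_src e := by rw [hf.cont_src]
  cont_tgt e := by rw [hf.cont_tgt]
  dirichlet v hv := by rw [hf.dirichlet v hv, mul_zero]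
  kirchhoff v hv := by
    have h1 := hf.kirchhoff v hv
    simp only [← Finset.mul_sum]
    linear_combination z * h1

variable {G D} in
theorem DomainData.unique {f f₁ f₂ g₁ g₂ : G.L2} {u u₁ w w₁ : G.E → ℝ → ℂ} {c d : G.V → ℂ}
    (hf : G.DomainData D f f₁ f₂ u u₁ c) (hg : G.DomainData D f g₁ g₂ w w₁ d) : f₂ = g₂ := by
  ext1 e
  have h1 : f₁ e = g₁ e := (hf.weak_one e).unique (hg.weak_one e)
  have h2 := hg.weak_two e
  rw [← h1] at h2
  exact (hf.weak_two e).unique h2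

/-- The continuous functions on `G` that are `H²` on each edge, with Dirichlet conditions at the
vertices in `D` and Kirchhoff conditions at the others. -/
def laplacianDomain : Submodule ℂ G.L2 where
  carrier := {f | ∃ f₁ f₂ u u₁ c, G.DomainData D f f₁ f₂ u u₁ c}
  zero_mem' := ⟨0, 0, fun _ _ => 0, fun _ _ => 0, fun _ => 0,
    { weak_one := fun _ => HasWeakDeriv.zero
      weak_two := fun _ => HasWeakDeriv.zero
      rep := fun _ => IsContRep.zero
      rep_one := fun _ => IsContRep.zero
      cont_src := fun _ => rfl
      cont_tgt := fun _ => rfl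
      dirichlet := fun _ _ => rfl
      kirchhoff := fun _ _ => by simp }⟩
  add_mem' := by
    rintro f g ⟨_, _, _, _, _, hf⟩ ⟨_, _, _, _, _, hg⟩
    exact ⟨_, _, _, _, _, hf.add hg⟩
  smul_mem' := by
    rintro z f ⟨_, _, _, _, _, hf⟩
    exact ⟨_, _, _, _, _, hf.smul z⟩

variable {G D} in
theorem exists_secondDeriv (f : G.laplacianDomain D) :
    ∃ f₂ : G.L2, ∃ f₁ u u₁ c, G.DomainData D f f₁ f₂ u u₁ c := by
  obtain ⟨f, f₁, f₂, u, u₁, c, h⟩ := f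
  exact ⟨f₂, f₁, u, u₁, c, h⟩

/-- The operator `f ↦ -f''` (edgewise weak second derivative) on `laplacianDomain`. -/
def laplacian : G.L2 →ₗ.[ℂ] G.L2 where
  domain := G.laplacianDomain D
  toFun :=
    { toFun := fun f => -(exists_secondDeriv f).choose
      map_add' := fun f g => by
        obtain ⟨_, _, _, _, h1⟩ := (exists_secondDeriv f).choose_spec
        obtain ⟨_, _, _, _, h2⟩ := (exists_secondDeriv g).choose_spec
        obtain ⟨_, _, _, _, h3⟩ := (exists_secondDeriv (f + g)).choose_spec
        rw [h3.unique (h1.add h2), neg_add]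
      map_smul' := fun z f => by
        obtain ⟨_, _, _, _, h1⟩ := (exists_secondDeriv f).choose_spec
        obtain ⟨_, _, _, _, h3⟩ := (exists_secondDeriv (z • f)).choose_spec
        rw [h3.unique (h1.smul z), RingHom.id_apply, smul_neg] }

variable {G D} in
theorem laplacian_apply {f : G.L2} (hf : f ∈ G.laplacianDomain D) {f₁ f₂ : G.L2}
    {u u₁ : G.E → ℝ → ℂ} {c : G.V → ℂ} (h : G.DomainData D f f₁ f₂ u u₁ c) :
    G.laplacian D ⟨f, hf⟩ = -f₂ := by
  obtain ⟨_, _, _, _, h1⟩ := (exists_secondDeriv (⟨f, hf⟩ : G.laplacianDomain D)).choose_spec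
  exact congrArg Neg.neg (h1.unique h)

end QuantumGraph

/-- The operator `B_n` on `F_n`. -/
def PlateConfiguration.B (C : PlateConfiguration) (n : ℕ) : (C.F n).L2 →ₗ.[ℂ] (C.F n).L2 :=
  (C.F n).laplacian (C.conducting n)

end

/-! The shape of the Laakso graphs and the position of the plates play no role: the Laplacian of any
finite metric graph, with Dirichlet conditions on any set of vertices and Kirchhoff conditions
elsewhere, is self-adjoint. It suffices that the operator `T` is symmetric and that `T + 1` is onto;
density of the domain then comes for free.

Symmetry is Green's identity `DomainData.inner_add_inner`: integration by parts on each edge leaves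
boundary terms, which cancel vertex by vertex. It rests on `HasWeakDeriv.isPrimitiveOn`, which turns
weak derivatives into absolutely continuous functions, for which the fundamental theorem of calculus
holds.

For surjectivity, `-f'' + f = h` is solved on each edge by variation of constants, and a correction
`α * exp x + β * exp (-x)` on each edge repairs the vertex conditions. The coefficients and vertex
values satisfy a square linear system, so solvability follows from uniqueness, which is Green's
identity again: `‖f'‖² + ‖f‖² = 0`. -/

/-! ### An abstract criterion for self-adjointness. -/

/-- A symmetric operator `T` for which `T + 1` is onto is densely defined and self-adjoint. -/
theorem LinearPMap.dense_and_isSelfAdjoint_of_surjective {H : Type*} [NormedAddCommGroup H]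
    [InnerProductSpace ℂ H] [CompleteSpace H] {T : H →ₗ.[ℂ] H} (hT : T.IsFormalAdjoint T)
    (hs : ∀ h : H, ∃ f : T.domain, T f + f = h) :
    Dense (T.domain : Set H) ∧ IsSelfAdjoint T := by
  have hd : Dense (T.domain : Set H) := by
    rw [Submodule.dense_iff_topologicalClosure_eq_top, Submodule.topologicalClosure_eq_top_iff,
      Submodule.eq_bot_iff]
    intro g hg
    -- For `g` orthogonal to the domain, write `g = (T + 1) f` and `f = (T + 1) k`. Symmetry gives
    -- `⟪f, f⟫ = ⟪k, g⟫ = 0`, so `f` and `g` vanish.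
    obtain ⟨f, rfl⟩ := hs g
    obtain ⟨k, hk⟩ := hs f
    have h1 : inner ℂ (k : H) (T f + f) = 0 := hg k k.2
    have h2 : inner ℂ (T k + k) (f : H) = 0 := by
      rw [inner_add_left, hT k f, ← inner_add_right, h1]
    rw [hk, inner_self_eq_zero] at h2
    have h3 : f = 0 := Subtype.ext h2
    simp [h3]
  have hle : T ≤ T.adjoint := LinearPMap.IsFormalAdjoint.le_adjoint hd hT
  refine ⟨hd, LinearPMap.isSelfAdjoint_def.2 (LinearPMap.eq_of_le_of_domain_eq hle ?_).symm⟩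
  refine le_antisymm hle.1 fun g hg => ?_
  -- With `(T + 1) f = (T* + 1) g`, the vector `g - f` is orthogonal to the range of `T + 1`, which
  -- is everything; hence `g = f` lies in the domain of `T`.
  obtain ⟨f, hf⟩ := hs (T.adjoint ⟨g, hg⟩ + g)
  suffices h : g - f = 0 by rw [sub_eq_zero.1 h]; exact f.2
  obtain ⟨k, hk⟩ := hs (g - f)
  have h1 : inner ℂ (T.adjoint ⟨g, hg⟩) (k : H) = inner ℂ g (T k) :=
    LinearPMap.adjoint_isFormalAdjoint hd ⟨g, hg⟩ k
  have h2 := hT f k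
  have h3 : inner ℂ (T f + f) (k : H) = inner ℂ (T.adjoint ⟨g, hg⟩ + g) (k : H) := by rw [hf]
  rw [← inner_self_eq_zero (𝕜 := ℂ)]
  have h4 : inner ℂ (g - f) (g - f : H) = inner ℂ (g - f : H) (T k + k) := by rw [hk]
  rw [h4, inner_add_right, inner_sub_left, inner_sub_left, ← h1, ← h2]
  rw [inner_add_left, inner_add_left] at h3
  linear_combination -h3

/-! ### Absolutely continuous functions and their almost everywhere derivatives. -/

/-- `u` is absolutely continuous on `[a, b]`, with almost everywhere derivative `v`. -/
structure IsPrimitiveOn (u v : ℝ → ℂ) (a b : ℝ) : Prop where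
  ac : AbsolutelyContinuousOnInterval u a b
  hasDerivAt : ∀ᵐ x, x ∈ Ioo a b → HasDerivAt u (v x) x
  integrable : IntervalIntegrable v volume a b

namespace IsPrimitiveOn

variable {a b : ℝ} {u v w z : ℝ → ℂ}

theorem continuousOn (h : IsPrimitiveOn u v a b) (hab : a ≤ b) : ContinuousOn u (Icc a b) := by
  simpa [uIcc_of_le hab] using h.ac.continuousOn

theorem congr_ae (h : IsPrimitiveOn u v a b) (hvw : v =ᵐ[volume.restrict (Ioo a b)] w)
    (hab : a ≤ b) : IsPrimitiveOn u w a b where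
  ac := h.ac
  hasDerivAt := by
    filter_upwards [h.hasDerivAt, (ae_restrict_iff' measurableSet_Ioo).1 hvw] with x h1 h2 hx
    rw [← h2 hx]
    exact h1 hx
  integrable := h.integrable.congr_ae (by
    rw [uIoc_of_le hab]
    rwa [← restrict_Ioo_eq_restrict_Ioc])

theorem add (h : IsPrimitiveOn u v a b) (h' : IsPrimitiveOn w z a b) :
    IsPrimitiveOn (fun x => u x + w x) (fun x => v x + z x) a b where
  ac := h.ac.fun_add h'.ac
  hasDerivAt := by
    filter_upwards [h.hasDerivAt, h'.hasDerivAt] with x h1 h2 hx using (h1 hx).add (h2 hx)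
  integrable := h.integrable.add h'.integrable

theorem mul (h : IsPrimitiveOn u v a b) (h' : IsPrimitiveOn w z a b) :
    IsPrimitiveOn (fun x => u x * w x) (fun x => v x * w x + u x * z x) a b where
  ac := h.ac.fun_smul h'.ac
  hasDerivAt := by
    filter_upwards [h.hasDerivAt, h'.hasDerivAt] with x h1 h2 hx using (h1 hx).mul (h2 hx)
  integrable := (h.integrable.mul_continuousOn h'.ac.continuousOn).add
    (h'.integrable.continuousOn_mul h.ac.continuousOn)

theorem conj (h : IsPrimitiveOn u v a b) :
    IsPrimitiveOn (fun x => starRingEnd ℂ (u x)) (fun x => starRingEnd ℂ (v x)) a b where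
  ac := by
    have := h.ac
    simp only [AbsolutelyContinuousOnInterval] at this ⊢
    simpa [Complex.dist_conj_conj] using this
  hasDerivAt := by
    filter_upwards [h.hasDerivAt] with x h1 hx using (h1 hx).star
  integrable := by
    have := h.integrable
    refine ⟨?_, ?_⟩
    · exact (Complex.conjCLE.toContinuousLinearMap.integrable_comp this.1)
    · exact (Complex.conjCLE.toContinuousLinearMap.integrable_comp this.2)

theorem of_integral (hv : IntervalIntegrable v volume a b) (hab : a ≤ b) :
    IsPrimitiveOn (fun x => ∫ t in a..x, v t) v a b where
  ac := by
    -- Absolute continuity is obtained for real integrands and applied to the real and imaginary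
    -- parts of `v`.
    have key : ∀ r : ℝ → ℝ, IntervalIntegrable r volume a b →
        AbsolutelyContinuousOnInterval (fun x => ((∫ t in a..x, r t : ℝ) : ℂ)) a b := by
      intro r hr
      have := hr.absolutelyContinuousOnInterval_intervalIntegral (c := a) left_mem_uIcc
      simp only [AbsolutelyContinuousOnInterval] at this ⊢
      simpa [Complex.isometry_ofReal.dist_eq] using this
    have hre := key (fun x => (v x).re) ⟨hv.1.re, hv.2.re⟩
    have him := key (fun x => (v x).im) ⟨hv.1.im, hv.2.im⟩
    have h := hre.fun_add (him.const_smul Complex.I)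
    -- Absolute continuity only tests values at points of `uIcc a b`, so an identity there transfers
    -- it.
    rw [absolutelyContinuousOnInterval_iff] at h ⊢
    have hsub : ∀ x ∈ uIcc a b, ((∫ t in a..x, (v t).re : ℝ) : ℂ)
        + Complex.I • ((∫ t in a..x, (v t).im : ℝ) : ℂ) = ∫ t in a..x, v t := by
      intro x hx
      have hvx : IntervalIntegrable v volume a x :=
        hv.mono_set (uIcc_subset_uIcc left_mem_uIcc hx)
      have h1 := Complex.reCLM.intervalIntegral_comp_comm hvx
      have h2 := Complex.imCLM.intervalIntegral_comp_comm hvx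
      simp only [Complex.reCLM_apply, Complex.imCLM_apply] at h1 h2
      rw [h1, h2, smul_eq_mul, mul_comm]
      exact Complex.re_add_im _
    intro ε hε
    obtain ⟨δ, hδ, H⟩ := h ε hε
    refine ⟨δ, hδ, fun E hE hEδ => ?_⟩
    have h3 := H E hE hEδ
    rwa [Finset.sum_congr rfl fun i hi => by
      rw [hsub _ (hE.1 i hi).1, hsub _ (hE.1 i hi).2]] at h3
  hasDerivAt := by
    filter_upwards [hv.ae_hasDerivAt_integral] with x h1 hx
    have : x ∈ uIcc a b := by rw [uIcc_of_le hab]; exact Ioo_subset_Icc_self hx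
    exact h1 this a (by simp)
  integrable := hv

theorem of_hasDerivAt (h : ∀ x, HasDerivAt u (v x) x) (hv : Continuous v) :
    IsPrimitiveOn u v a b where
  ac := by
    refine ContDiffOn.absolutelyContinuousOnInterval (ContDiff.contDiffOn ?_)
    rw [contDiff_one_iff_deriv]
    refine ⟨fun x => (h x).differentiableAt, ?_⟩
    rwa [show deriv u = v from funext fun x => (h x).deriv]
  hasDerivAt := Filter.Eventually.of_forall fun x _ => h x
  integrable := hv.intervalIntegrable _ _

theorem const (c : ℂ) : IsPrimitiveOn (fun _ => c) (fun _ => 0) a b :=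
  of_hasDerivAt (fun x => hasDerivAt_const x c) continuous_const

/-- The difference of `u` and the indefinite integral of `v` is absolutely continuous with
derivative zero almost everywhere, hence constant. -/
theorem integral_eq_sub (h : IsPrimitiveOn u v a b) (hab : a ≤ b) :
    ∫ x in Ioo a b, v x = u b - u a := by
  have hI := of_integral h.integrable hab
  have hac := h.ac.fun_sub hI.ac
  obtain ⟨C, hC⟩ := hac.const_of_ae_hasDerivAt_zero (by
    have ha : ∀ᵐ x : ℝ, x ≠ a := by simp [ae_iff]
    have hb : ∀ᵐ x : ℝ, x ≠ b := by simp [ae_iff]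
    filter_upwards [h.hasDerivAt, hI.hasDerivAt, ha, hb] with x h1 h2 h3 h4 hx
    rw [uIcc_of_le hab] at hx
    have hx' : x ∈ Ioo a b := ⟨lt_of_le_of_ne hx.1 h3.symm, lt_of_le_of_ne hx.2 h4⟩
    have h5 := (h1 hx').fun_sub (h2 hx')
    rwa [sub_self] at h5)
  have h1 := hC a (by simp)
  have h2 := hC b (by simp)
  simp only [intervalIntegral.integral_same, sub_zero] at h1
  rw [← integral_Ioc_eq_integral_Ioo, ← intervalIntegral.integral_of_le hab, h1, ← h2]
  ring

end IsPrimitiveOn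

/-! ### From weak derivatives to absolutely continuous representatives, and integration by parts. -/

section WeakDerivative

variable {a b : ℝ}

theorem IntervalL2.intervalIntegrable (f : IntervalL2 a b) (hab : a ≤ b) :
    IntervalIntegrable f volume a b := by
  rw [intervalIntegrable_iff_integrableOn_Ioo_of_le hab]
  exact (Lp.memLp f).integrable (by norm_num)

theorem exists_Icc_of_isCompact_subset_Ioo {K : Set ℝ} (hK : IsCompact K) (h : K ⊆ Ioo a b)
    (hne : K.Nonempty) : ∃ s t, a < s ∧ t < b ∧ s ≤ t ∧ K ⊆ Icc s t := by
  obtain ⟨s, hs, hs'⟩ := hK.exists_isLeast hne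
  obtain ⟨t, ht, ht'⟩ := hK.exists_isGreatest hne
  exact ⟨s, t, (h hs).1, (h ht).2, hs' ht, fun x hx => ⟨hs' hx, ht' hx⟩⟩

/-- A test function whose integral vanishes is the derivative of a test function. -/
theorem exists_testFunction_deriv_eq {φ : ℝ → ℝ} (hφ : ContDiff ℝ ∞ φ)
    (hc : HasCompactSupport φ) (hs : tsupport φ ⊆ Ioo a b) (hi : ∫ x in Ioo a b, φ x = 0) :
    ∃ ψ : ℝ → ℝ, ContDiff ℝ ∞ ψ ∧ HasCompactSupport ψ ∧ tsupport ψ ⊆ Ioo a b ∧ deriv ψ = φ := by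
  rcases (tsupport φ).eq_empty_or_nonempty with he | hne
  · refine ⟨0, contDiff_const, HasCompactSupport.zero, by simp [tsupport], ?_⟩
    rw [tsupport_eq_empty_iff.1 he]
    funext x
    simp
  obtain ⟨s, t, has, htb, hst, hK⟩ := exists_Icc_of_isCompact_subset_Ioo hc hs hne
  have hz : ∀ x, x ∉ Icc s t → φ x = 0 := fun x hx =>
    image_eq_zero_of_notMem_tsupport fun h => hx (hK h)
  have hd : ∀ x, HasDerivAt (fun x => ∫ y in a..x, φ y) (φ x) x := fun x =>
    hφ.continuous.integral_hasStrictDerivAt a x |>.hasDerivAt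
  have hd' : deriv (fun x => ∫ y in a..x, φ y) = φ := funext fun x => (hd x).deriv
  have hab : ∫ y in a..b, φ y = 0 := by
    rw [intervalIntegral.integral_of_le (by linarith), integral_Ioc_eq_integral_Ioo, hi]
  -- The antiderivative from `a` vanishes left of `s` because `φ` does, and right of `t` because the
  -- total integral of `φ` is zero.
  have hsupp : Function.support (fun x => ∫ y in a..x, φ y) ⊆ Icc s t := by
    intro x hx
    by_contra hxn
    apply hx
    rw [mem_Icc, not_and_or, not_le, not_le] at hxn
    rcases hxn with hxs | hxt
    · refine intervalIntegral.integral_zero_ae (Filter.Eventually.of_forall fun y hy => hz y ?_)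
      intro hy'
      have := hy.2
      rcases le_max_iff.1 this with h | h <;> linarith [hy'.1]
    · have h1 : ∫ y in x..b, φ y = 0 := by
        refine intervalIntegral.integral_zero_ae (Filter.Eventually.of_forall fun y hy => hz y ?_)
        intro hy'
        have := hy.1
        rcases min_lt_iff.1 this with h | h <;> linarith [hy'.2]
      have h2 := intervalIntegral.integral_add_adjacent_intervals
        (hφ.continuous.intervalIntegrable (μ := volume) a x)
        (hφ.continuous.intervalIntegrable (μ := volume) x b)
      rw [h1, hab, add_zero] at h2
      exact h2
  have hts : tsupport (fun x => ∫ y in a..x, φ y) ⊆ Icc s t :=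
    closure_minimal hsupp isClosed_Icc
  refine ⟨fun x => ∫ y in a..x, φ y, ?_, HasCompactSupport.of_support_subset_isCompact
    isCompact_Icc hsupp, hts.trans (Icc_subset_Ioo has htb), hd'⟩
  rw [contDiff_infty_iff_deriv, hd']
  exact ⟨fun x => (hd x).differentiableAt, hφ⟩

/-- Subtracting a multiple of such a bump gives any test function integral zero, and so makes it the
derivative of a test function. -/
theorem exists_testFunction_integral_eq_one (hab : a < b) :
    ∃ ρ : ℝ → ℝ, ContDiff ℝ ∞ ρ ∧ HasCompactSupport ρ ∧ tsupport ρ ⊆ Ioo a b ∧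
      ∫ x in Ioo a b, ρ x = 1 := by
  have hm : (a + b) / 2 ∈ Ioo a b := ⟨by linarith, by linarith⟩
  obtain ⟨f, h1, h2, h3, h4, h5⟩ := exists_contDiff_tsupport_subset (n := ⊤)
    (isOpen_Ioo.mem_nhds hm)
  have hpos : 0 < ∫ x, f x := by
    refine h3.continuous.integral_pos_of_hasCompactSupport_nonneg_nonzero h2
      (fun x => (h4 (mem_range_self x)).1) (x := (a + b) / 2) ?_
    rw [h5]; exact one_ne_zero
  have heq : ∫ x in Ioo a b, f x = ∫ x, f x :=
    setIntegral_eq_integral_of_forall_compl_eq_zero fun x hx =>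
      image_eq_zero_of_notMem_tsupport fun h => hx (h1 h)
  refine ⟨fun x => (∫ x, f x)⁻¹ * f x, contDiff_const.mul h3, h2.mul_left,
    tsupport_mul_subset_right.trans h1, ?_⟩
  rw [integral_const_mul, heq, inv_mul_cancel₀ hpos.ne']

/-- The product `φ * u` has a primitive-derivative pair by the product rule, and its boundary values
vanish because `φ` is supported in the open interval. -/
theorem IsPrimitiveOn.integral_deriv_smul {u v : ℝ → ℂ} (h : IsPrimitiveOn u v a b)
    (hab : a ≤ b) {φ : ℝ → ℝ} (hφ : ContDiff ℝ ∞ φ) (hs : tsupport φ ⊆ Ioo a b) :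
    ∫ x in Ioo a b, deriv φ x • u x = -∫ x in Ioo a b, φ x • v x := by
  have hφ1 : IsPrimitiveOn (fun x => (φ x : ℂ)) (fun x => ((deriv φ x : ℝ) : ℂ)) a b :=
    IsPrimitiveOn.of_hasDerivAt
      (fun x => ((hφ.differentiable (by simp)) x).hasDerivAt.ofReal_comp)
      (Complex.continuous_ofReal.comp (hφ.continuous_deriv (by simp)))
  have h1 := (hφ1.mul h).integral_eq_sub hab
  have ha : φ a = 0 := image_eq_zero_of_notMem_tsupport fun h => (hs h).1.false
  have hb : φ b = 0 := image_eq_zero_of_notMem_tsupport fun h => (hs h).2.false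
  rw [ha, hb, integral_add] at h1
  · simp only [Complex.real_smul]
    rw [Complex.ofReal_zero, zero_mul, zero_mul, sub_zero] at h1
    linear_combination h1
  · have := hφ1.integrable.mul_continuousOn h.ac.continuousOn
    rwa [intervalIntegrable_iff_integrableOn_Ioo_of_le hab] at this
  · have := h.integrable.continuousOn_mul hφ1.ac.continuousOn
    rwa [intervalIntegrable_iff_integrableOn_Ioo_of_le hab] at this

theorem IsPrimitiveOn.hasWeakDeriv {f g : IntervalL2 a b} {u : ℝ → ℂ}
    (h : IsPrimitiveOn u g a b) (hab : a ≤ b) (hf : f =ᵐ[volume.restrict (Ioo a b)] u) :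
    HasWeakDeriv f g := by
  intro φ h1 _ h3
  rw [← h.integral_deriv_smul hab h1 h3]
  refine integral_congr_ae ?_
  filter_upwards [hf] with x hx
  rw [hx]

/-- A continuous function whose weak derivative vanishes is constant. -/
theorem exists_eq_const_of_integral_deriv_smul_eq_zero {W : ℝ → ℂ} (hab : a < b)
    (hW : ContinuousOn W (Icc a b))
    (h : ∀ φ : ℝ → ℝ, ContDiff ℝ ∞ φ → HasCompactSupport φ → tsupport φ ⊆ Ioo a b →
      ∫ x in Ioo a b, deriv φ x • W x = 0) : ∃ c, ∀ x ∈ Icc a b, W x = c := by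
  obtain ⟨ρ, r1, r2, r3, r4⟩ := exists_testFunction_integral_eq_one hab
  have hWi : IntegrableOn W (Ioo a b) := (hW.integrableOn_Icc).mono_set Ioo_subset_Icc_self
  have hi : ∀ φ : ℝ → ℝ, Continuous φ → HasCompactSupport φ →
      IntegrableOn (fun x => φ x • W x) (Ioo a b) := by
    intro φ hφ hc
    obtain ⟨M, hM⟩ := hc.exists_bound_of_continuous hφ
    exact hWi.bdd_smul M hφ.aestronglyMeasurable (Filter.Eventually.of_forall hM)
  -- The constant must be the mean of `W` against the normalised bump `ρ`.
  refine ⟨∫ x in Ioo a b, ρ x • W x, ?_⟩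
  have h0 : ∀ᵐ x ∂volume, x ∈ Ioo a b → (W x - ∫ x in Ioo a b, ρ x • W x) = 0 := by
    refine isOpen_Ioo.ae_eq_zero_of_integral_contDiff_smul_eq_zero
      (hWi.sub (integrableOn_const (by simp))).locallyIntegrableOn ?_
    intro φ h1 h2 h3
    have hz : ∀ x, x ∉ Ioo a b → φ x • (W x - ∫ x in Ioo a b, ρ x • W x) = 0 := by
      intro x hx
      rw [image_eq_zero_of_notMem_tsupport (fun hx' => hx (h3 hx')), zero_smul]
    rw [← setIntegral_eq_integral_of_forall_compl_eq_zero hz]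
    have hφi : IntegrableOn φ (Ioo a b) := (h1.continuous.integrable_of_hasCompactSupport h2).integrableOn
    have hρi : IntegrableOn ρ (Ioo a b) := (r1.continuous.integrable_of_hasCompactSupport r2).integrableOn
    -- Since `φ - m * ρ` has integral zero, it is some `deriv ψ`; the hypothesis on `ψ` says that `∫
    -- φ W = m ∫ ρ W`, which is the required identity.
    obtain ⟨m, hm⟩ : ∃ m, m = ∫ x in Ioo a b, φ x := ⟨_, rfl⟩
    have c1 : ContDiff ℝ ∞ (fun x => φ x - m * ρ x) := h1.sub (contDiff_const.mul r1)
    have c2 : HasCompactSupport (fun x => φ x - m * ρ x) := h2.sub r2.mul_left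
    have c3 : tsupport (fun x => φ x - m * ρ x) ⊆ Ioo a b :=
      (tsupport_sub φ (fun x => m * ρ x)).trans (union_subset h3
        (tsupport_mul_subset_right.trans r3))
    obtain ⟨ψ, p1, p2, p3, p4⟩ := exists_testFunction_deriv_eq c1 c2 c3 (by
      rw [integral_sub hφi (hρi.const_mul m), integral_const_mul, r4, hm]; ring)
    have h4 := h ψ p1 p2 p3
    rw [p4] at h4
    simp only [sub_smul, mul_smul] at h4
    have hρW : IntegrableOn (fun x => m • ρ x • W x) (Ioo a b) :=
      (hi ρ r1.continuous r2).smul m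
    rw [integral_sub (hi φ h1.continuous h2) hρW,
      integral_smul, hm] at h4
    simp only [smul_sub]
    rw [integral_sub (hi φ h1.continuous h2) (hφi.smul_const _), integral_smul_const]
    exact h4
  have h1 := Measure.eqOn_Icc_of_ae_eq volume hab.ne (f := W)
    (g := fun _ => ∫ x in Ioo a b, ρ x • W x) (by
      rw [← restrict_Ioo_eq_restrict_Icc]
      filter_upwards [(ae_restrict_iff' measurableSet_Ioo).2 h0] with x hx using sub_eq_zero.1 hx)
    hW continuousOn_const
  exact h1

/-- The difference of `u` and the indefinite integral of `g` is continuous with weak derivative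
zero, hence constant (du Bois-Reymond). -/
theorem HasWeakDeriv.isPrimitiveOn {f g : IntervalL2 a b} {u : ℝ → ℂ} (h : HasWeakDeriv f g)
    (hu : IsContRep f u) (hab : a < b) : IsPrimitiveOn u g a b := by
  have hg := g.intervalIntegrable hab.le
  have hI := IsPrimitiveOn.of_integral hg hab.le
  obtain ⟨c, hc⟩ := exists_eq_const_of_integral_deriv_smul_eq_zero
    (W := fun x => u x - ∫ t in a..x, g t) hab (hu.1.sub (hI.continuousOn hab.le)) (by
      intro φ h1 h2 h3
      have e1 := h φ h1 h2 h3
      rw [← hI.integral_deriv_smul hab.le h1 h3] at e1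
      have e2 : ∫ x in Ioo a b, deriv φ x • u x = ∫ x in Ioo a b, deriv φ x • f x :=
        integral_congr_ae (by filter_upwards [hu.2] with x hx; rw [hx])
      have hbd : ∀ w : ℝ → ℂ, ContinuousOn w (Icc a b) →
          IntegrableOn (fun x => deriv φ x • w x) (Ioo a b) := fun w hw =>
        ((h1.continuous_deriv (by simp)).continuousOn.smul hw).integrableOn_Icc.mono_set
          Ioo_subset_Icc_self
      simp only [smul_sub]
      rw [integral_sub (hbd u hu.1) (hbd _ (hI.continuousOn hab.le)), e2, e1, sub_self])
  have hC := hI.add (IsPrimitiveOn.const c)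
  have heq : ∀ x ∈ Icc a b, (∫ t in a..x, g t) + c = u x := fun x hx => by
    rw [← hc x hx]; ring
  refine ⟨?_, ?_, hg⟩
  · have := hC.ac
    rw [absolutelyContinuousOnInterval_iff] at this ⊢
    intro ε hε
    obtain ⟨δ, hδ, H⟩ := this ε hε
    refine ⟨δ, hδ, fun E hE hEδ => ?_⟩
    have h3 := H E hE hEδ
    rwa [Finset.sum_congr rfl fun i hi => by
      rw [heq _ (uIcc_of_le hab.le ▸ (hE.1 i hi).1),
        heq _ (uIcc_of_le hab.le ▸ (hE.1 i hi).2)]] at h3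
  · filter_upwards [hC.hasDerivAt] with x h1 hx
    have h2 := h1 hx
    rw [add_zero] at h2
    refine h2.congr_of_eventuallyEq ?_
    filter_upwards [isOpen_Ioo.mem_nhds hx] with y hy using (heq y (Ioo_subset_Icc_self hy)).symm

/-- Integration by parts for weak derivatives. -/
theorem HasWeakDeriv.inner_add_inner {f f' g g' : IntervalL2 a b} {u v : ℝ → ℂ}
    (hf : HasWeakDeriv f f') (hg : HasWeakDeriv g g') (hu : IsContRep f u) (hv : IsContRep g v)
    (hab : a < b) :
    inner ℂ f' g + inner ℂ f g'
      = starRingEnd ℂ (u b) * v b - starRingEnd ℂ (u a) * v a := by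
  rw [← (((hf.isPrimitiveOn hu hab).conj.mul (hg.isPrimitiveOn hv hab)).integral_eq_sub hab.le),
    L2.inner_def, L2.inner_def, ← integral_add (L2.integrable_inner f' g)
      (L2.integrable_inner f g')]
  refine integral_congr_ae ?_
  filter_upwards [hu.2, hv.2] with x h1 h2
  simp only [RCLike.inner_apply, h1, h2]
  ring

theorem IsContRep.eqOn {f : IntervalL2 a b} {u v : ℝ → ℂ} (hu : IsContRep f u)
    (hv : IsContRep f v) (hab : a < b) : EqOn u v (Icc a b) :=
  Measure.eqOn_Icc_of_ae_eq volume hab.ne (by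
    rw [← restrict_Ioo_eq_restrict_Icc]; exact hu.2.symm.trans hv.2) hu.1 hv.1

end WeakDerivative

/-! ### The equation `-w'' + w = h` on an interval. -/

namespace IsPrimitiveOn

variable {a b : ℝ} {u v w : ℝ → ℂ}

theorem memLp (h : IsPrimitiveOn u v a b) (hab : a ≤ b) :
    MemLp u 2 (volume.restrict (Ioo a b)) := by
  obtain ⟨C, hC⟩ := h.ac.exists_bound
  refine MemLp.of_bound (((h.continuousOn hab).mono Ioo_subset_Icc_self).aestronglyMeasurable
    measurableSet_Ioo) C ?_
  refine (ae_restrict_iff' measurableSet_Ioo).2 (Filter.Eventually.of_forall fun x hx => ?_)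
  exact hC x (uIcc_of_le hab ▸ Ioo_subset_Icc_self hx)

theorem isContRep_toLp (h : IsPrimitiveOn u v a b) (hab : a ≤ b) :
    IsContRep ((h.memLp hab).toLp u) u :=
  ⟨h.continuousOn hab, MemLp.coeFn_toLp _⟩

theorem hasDerivAt_cexp (x : ℝ) :
    HasDerivAt (fun x : ℝ => Complex.exp x) (Complex.exp x) x :=
  (Complex.hasDerivAt_exp _).comp_ofReal

theorem hasDerivAt_cexp_neg (x : ℝ) :
    HasDerivAt (fun x : ℝ => Complex.exp (-x)) (-Complex.exp (-x)) x := by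
  simpa using ((hasDerivAt_id (x : ℂ)).neg.cexp).comp_ofReal

theorem cexp : IsPrimitiveOn (fun x : ℝ => Complex.exp x) (fun x : ℝ => Complex.exp x) a b :=
  of_hasDerivAt hasDerivAt_cexp (by fun_prop)

theorem cexp_neg :
    IsPrimitiveOn (fun x : ℝ => Complex.exp (-x)) (fun x : ℝ => -Complex.exp (-x)) a b :=
  of_hasDerivAt hasDerivAt_cexp_neg (by fun_prop)

/-- Variation of constants for `-w'' + w = h`. -/
theorem exists_solution {h : ℝ → ℂ} (hh : IntervalIntegrable h volume a b) (hab : a ≤ b) :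
    ∃ w w₁ : ℝ → ℂ, IsPrimitiveOn w w₁ a b ∧ IsPrimitiveOn w₁ (fun x => w x - h x) a b := by
  have hE : ∀ x : ℝ, Complex.exp x * Complex.exp (-x) = 1 := fun x => by
    rw [← Complex.exp_add, add_neg_cancel, Complex.exp_zero]
  -- The solution is `w = A * exp x + B * exp (-x)` with `A' = -exp (-x) * h / 2` and `B' = exp x *
  -- h / 2`. Then `A' * exp x + B' * exp (-x) = 0`, so `w' = A * exp x - B * exp (-x)`, and `A' *
  -- exp x - B' * exp (-x) = -h`, so `w'' = w - h`.
  have hA := of_integral (hh.continuousOn_mul (f := h)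
    (g := fun x : ℝ => -(1 / 2) * Complex.exp (-x)) (by fun_prop)) hab
  have hB := of_integral (hh.continuousOn_mul (f := h)
    (g := fun x : ℝ => (1 / 2) * Complex.exp x) (by fun_prop)) hab
  have h1 := (hA.mul cexp).add (hB.mul cexp_neg)
  have h2 := (hA.mul cexp).add ((hB.mul cexp_neg).mul (const (-1)))
  refine ⟨_, _, h1.congr_ae (Filter.Eventually.of_forall fun x => ?_) hab,
    h2.congr_ae (Filter.Eventually.of_forall fun x => ?_) hab⟩
  · simp only
    ring
  · simp only
    linear_combination -h x * hE x

theorem exp_add_exp (α β : ℂ) :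
    IsPrimitiveOn (fun x : ℝ => α * Complex.exp x + β * Complex.exp (-x))
      (fun x : ℝ => α * Complex.exp x - β * Complex.exp (-x)) a b :=
  of_hasDerivAt (fun x => by
    simpa [sub_eq_add_neg] using ((hasDerivAt_cexp x).const_mul α).fun_add
      ((hasDerivAt_cexp_neg x).const_mul β)) (by fun_prop)

theorem exp_sub_exp (α β : ℂ) :
    IsPrimitiveOn (fun x : ℝ => α * Complex.exp x - β * Complex.exp (-x))
      (fun x : ℝ => α * Complex.exp x + β * Complex.exp (-x)) a b :=
  of_hasDerivAt (fun x => by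
    simpa [sub_eq_add_neg] using ((hasDerivAt_cexp x).const_mul α).fun_sub
      ((hasDerivAt_cexp_neg x).const_mul β)) (by fun_prop)

end IsPrimitiveOn

/-! ### Green's identity on a graph, symmetry and uniqueness. -/

namespace QuantumGraph

variable {G : QuantumGraph} {D : Set G.V}

/-- Regroups the boundary terms of the edges by vertex; `s` is the left or the right endpoint map.
-/
theorem sum_edges_conj_mul (s : G.E → G.V) (c : G.V → ℂ) (r : G.E → ℝ → ℂ) :
    ∑ e, starRingEnd ℂ (c (s e)) * r e (G.x (s e))
      = ∑ v, starRingEnd ℂ (c v) * (open Classical in ∑ e with s e = v, r e (G.x v)) := by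
  classical
  rw [← Finset.sum_fiberwise (s := Finset.univ) (g := s)]
  refine Finset.sum_congr rfl fun v _ => ?_
  rw [Finset.mul_sum]
  exact Finset.sum_congr (by congr) fun e he => by rw [(Finset.mem_filter.1 he).2]

/-- Green's identity. -/
theorem DomainData.inner_add_inner {f f₁ f₂ g g₁ g₂ : G.L2} {u u₁ w w₁ : G.E → ℝ → ℂ}
    {c d : G.V → ℂ} (hf : G.DomainData D f f₁ f₂ u u₁ c) (hg : G.DomainData D g g₁ g₂ w w₁ d) :
    inner ℂ f₁ g₁ + inner ℂ f g₂ = 0 := by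
  rw [PiLp.inner_apply, PiLp.inner_apply, ← Finset.sum_add_distrib]
  have h : ∀ e, inner ℂ (f₁ e) (g₁ e) + inner ℂ (f e) (g₂ e)
      = starRingEnd ℂ (c (G.tgt e)) * w₁ e (G.x (G.tgt e))
        - starRingEnd ℂ (c (G.src e)) * w₁ e (G.x (G.src e)) := fun e => by
    rw [(hf.weak_one e).inner_add_inner (hg.weak_two e) (hf.rep e) (hg.rep_one e) (G.x_lt e),
      hf.cont_src, hf.cont_tgt]
  rw [Finset.sum_congr rfl fun e _ => h e, Finset.sum_sub_distrib, sum_edges_conj_mul G.tgt,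
    sum_edges_conj_mul G.src, ← Finset.sum_sub_distrib]
  refine Finset.sum_eq_zero fun v _ => ?_
  -- At a vertex of `D` the value of `f` kills the term; elsewhere the Kirchhoff condition of `g`
  -- does.
  by_cases hv : v ∈ D
  · rw [hf.dirichlet v hv]
    simp
  · linear_combination -starRingEnd ℂ (c v) * hg.kirchhoff v hv

/-- By Green's identity and its conjugate, both sides equal `⟪f', g'⟫`. -/
theorem isFormalAdjoint_laplacian : (G.laplacian D).IsFormalAdjoint (G.laplacian D) := by
  rintro ⟨f, hfD⟩ ⟨g, hgD⟩
  obtain ⟨f₁, f₂, u, u₁, c, hf⟩ := id hfD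
  obtain ⟨g₁, g₂, w, w₁, d, hg⟩ := id hgD
  rw [laplacian_apply hfD hf, laplacian_apply hgD hg, inner_neg_left, inner_neg_right]
  have h1 := hf.inner_add_inner hg
  have h2 := congrArg (starRingEnd ℂ) (hg.inner_add_inner hf)
  rw [map_add, inner_conj_symm, inner_conj_symm, map_zero] at h2
  linear_combination h1 - h2

/-- Only the zero function in the domain satisfies `-f'' + f = 0`. -/
theorem DomainData.eq_zero {f f₁ : G.L2} {u u₁ : G.E → ℝ → ℂ} {c : G.V → ℂ}
    (hf : G.DomainData D f f₁ f u u₁ c) : f = 0 ∧ f₁ = 0 := by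
  -- With `f'' = f`, Green's identity for the pair `(f, f)` reads `‖f'‖² + ‖f‖² = 0`.
  have h := congrArg (RCLike.re : ℂ → ℝ) (hf.inner_add_inner hf)
  rw [map_add, inner_self_eq_norm_sq, inner_self_eq_norm_sq, map_zero] at h
  constructor
  · exact norm_eq_zero.1 ((pow_eq_zero_iff two_ne_zero).1
      (by linarith [sq_nonneg ‖f‖, sq_nonneg ‖f₁‖]))
  · exact norm_eq_zero.1 ((pow_eq_zero_iff two_ne_zero).1
      (by linarith [sq_nonneg ‖f‖, sq_nonneg ‖f₁‖]))

/-- Passes from pointwise edge functions to `L²` classes; the second derivative has the form `f - h`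
because the functions of interest solve `-f'' + f = h`. -/
theorem exists_domainData {h : G.L2} {u u₁ : G.E → ℝ → ℂ} {c : G.V → ℂ}
    (hu : ∀ e, IsPrimitiveOn (u e) (u₁ e) (G.x (G.src e)) (G.x (G.tgt e)))
    (hu₁ : ∀ e, IsPrimitiveOn (u₁ e) (fun x => u e x - h e x) (G.x (G.src e)) (G.x (G.tgt e)))
    (hs : ∀ e, u e (G.x (G.src e)) = c (G.src e)) (ht : ∀ e, u e (G.x (G.tgt e)) = c (G.tgt e))
    (hD : ∀ v ∈ D, c v = 0)
    (hK : ∀ v ∉ D, open Classical in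
      (∑ e with G.src e = v, u₁ e (G.x v)) - (∑ e with G.tgt e = v, u₁ e (G.x v)) = 0) :
    ∃ f f₁ : G.L2, G.DomainData D f f₁ (f - h) u u₁ c := by
  have hle := fun e => (G.x_lt e).le
  have r := fun e => (hu e).isContRep_toLp (hle e)
  have r₁ := fun e => (hu₁ e).isContRep_toLp (hle e)
  refine ⟨WithLp.toLp 2 fun e => ((hu e).memLp (hle e)).toLp (u e),
    WithLp.toLp 2 fun e => ((hu₁ e).memLp (hle e)).toLp (u₁ e),
    { weak_one := fun e => ?_
      weak_two := fun e => ?_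
      rep := r
      rep_one := r₁
      cont_src := hs
      cont_tgt := ht
      dirichlet := hD
      kirchhoff := hK }⟩
  · exact ((hu e).congr_ae (r₁ e).2.symm (hle e)).hasWeakDeriv (hle e) (r e).2
  · refine ((hu₁ e).congr_ae ?_ (hle e)).hasWeakDeriv (hle e) (r₁ e).2
    refine Filter.EventuallyEq.symm ((Lp.coeFn_sub _ _).trans ?_)
    filter_upwards [(r e).2] with x hx
    exact congrArg (· - h e x) hx

end QuantumGraph

/-! ### The linear system of vertex conditions and the surjectivity of `T + 1`. -/

namespace QuantumGraph

variable (G : QuantumGraph) (D : Set G.V)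

open Classical in
/-- The vertex conditions for the family `α e * exp x + β e * exp (-x)` of edge functions with
vertex values `c`: the defects of continuity at the two ends of the edges, and the value or the sum
of the derivatives at a vertex. -/
noncomputable def vertexConditions :
    (G.E → ℂ) × (G.E → ℂ) × (G.V → ℂ) →ₗ[ℂ] (G.E → ℂ) × (G.E → ℂ) × (G.V → ℂ) where
  toFun p :=
    (fun e => p.1 e * Complex.exp (G.x (G.src e)) + p.2.1 e * Complex.exp (-G.x (G.src e))
        - p.2.2 (G.src e),
      fun e => p.1 e * Complex.exp (G.x (G.tgt e)) + p.2.1 e * Complex.exp (-G.x (G.tgt e))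
        - p.2.2 (G.tgt e),
      fun v => if v ∈ D then p.2.2 v else
        (∑ e with G.src e = v, (p.1 e * Complex.exp (G.x v) - p.2.1 e * Complex.exp (-G.x v)))
          - ∑ e with G.tgt e = v, (p.1 e * Complex.exp (G.x v) - p.2.1 e * Complex.exp (-G.x v)))
  map_add' p q := by
    refine Prod.ext (funext fun e => ?_) (Prod.ext (funext fun e => ?_) (funext fun v => ?_))
    · simp only [Prod.fst_add, Prod.snd_add, Pi.add_apply]
      ring
    · simp only [Prod.fst_add, Prod.snd_add, Pi.add_apply]
      ring
    · simp only [Prod.fst_add, Prod.snd_add, Pi.add_apply, add_mul, Finset.sum_sub_distrib,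
        Finset.sum_add_distrib]
      split_ifs <;> ring
  map_smul' z p := by
    refine Prod.ext (funext fun e => ?_) (Prod.ext (funext fun e => ?_) (funext fun v => ?_))
    · simp only [Prod.smul_fst, Prod.smul_snd, Pi.smul_apply, smul_eq_mul, RingHom.id_apply]
      ring
    · simp only [Prod.smul_fst, Prod.smul_snd, Pi.smul_apply, smul_eq_mul, RingHom.id_apply]
      ring
    · simp only [Prod.smul_fst, Prod.smul_snd, Pi.smul_apply, smul_eq_mul, RingHom.id_apply,
        mul_assoc, Finset.sum_sub_distrib, ← Finset.mul_sum]
      split_ifs <;> ring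

variable {G D}

/-- The system is square, so injectivity suffices; a kernel element defines a solution of `-f'' + f
= 0` in the domain, which is zero. Without `hD`, the value at an isolated vertex outside `D` would
be a free unknown. -/
theorem vertexConditions_surjective (hD : ∀ v ∉ D, ∃ e, G.src e = v ∨ G.tgt e = v) :
    Function.Surjective (G.vertexConditions D) := by
  rw [← LinearMap.injective_iff_surjective, injective_iff_map_eq_zero]
  rintro ⟨α, β, c⟩ h
  have hs : ∀ e, α e * Complex.exp (G.x (G.src e)) + β e * Complex.exp (-G.x (G.src e))
      = c (G.src e) := fun e => sub_eq_zero.1 (congrFun (congrArg Prod.fst h) e)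
  have ht : ∀ e, α e * Complex.exp (G.x (G.tgt e)) + β e * Complex.exp (-G.x (G.tgt e))
      = c (G.tgt e) := fun e => sub_eq_zero.1 (congrFun (congrArg (fun q => q.2.1) h) e)
  have hv : ∀ v, (G.vertexConditions D (α, β, c)).2.2 v = 0 := fun v =>
    congrFun (congrArg (fun q => q.2.2) h) v
  have hc : ∀ v ∈ D, c v = 0 := fun v hvD => by
    have := hv v
    simpa [vertexConditions, hvD] using this
  obtain ⟨f, f₁, hf⟩ := exists_domainData (D := D) (h := 0) (c := c)
    (u := fun e x => α e * Complex.exp x + β e * Complex.exp (-x))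
    (u₁ := fun e x => α e * Complex.exp x - β e * Complex.exp (-x))
    (fun e => IsPrimitiveOn.exp_add_exp _ _)
    (fun e => (IsPrimitiveOn.exp_sub_exp _ _).congr_ae (by
      filter_upwards [Lp.coeFn_zero ℂ 2
        (volume.restrict (Ioo (G.x (G.src e)) (G.x (G.tgt e))))] with x hx
      exact (sub_eq_self.2 hx).symm) (G.x_lt e).le)
    hs ht hc (fun v hvD => by
      have := hv v
      simp only [vertexConditions, LinearMap.coe_mk, AddHom.coe_mk, if_neg hvD] at this
      exact this)
  rw [sub_zero] at hf
  obtain ⟨h0, h1⟩ := hf.eq_zero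
  -- Value and derivative vanish at the left endpoint: `α * exp x ± β * exp (-x) = 0`.
  have key : ∀ e, α e = 0 ∧ β e = 0 := fun e => by
    have hm : G.x (G.src e) ∈ Icc (G.x (G.src e)) (G.x (G.tgt e)) :=
      left_mem_Icc.2 (G.x_lt e).le
    have r := hf.rep e
    have r₁ := hf.rep_one e
    rw [h0] at r
    rw [h1] at r₁
    have e0 : α e * Complex.exp (G.x (G.src e)) + β e * Complex.exp (-G.x (G.src e)) = 0 :=
      r.eqOn IsContRep.zero (G.x_lt e) hm
    have e1 : α e * Complex.exp (G.x (G.src e)) - β e * Complex.exp (-G.x (G.src e)) = 0 :=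
      r₁.eqOn IsContRep.zero (G.x_lt e) hm
    constructor
    · refine (mul_eq_zero.1 ?_).resolve_right (Complex.exp_ne_zero (G.x (G.src e)))
      linear_combination (e0 + e1) / 2
    · refine (mul_eq_zero.1 ?_).resolve_right (Complex.exp_ne_zero (-G.x (G.src e)))
      linear_combination (e0 - e1) / 2
  refine Prod.ext (funext fun e => (key e).1) (Prod.ext (funext fun e => (key e).2)
    (funext fun v => ?_))
  change c v = 0
  by_cases hvD : v ∈ D
  · exact hc v hvD
  · obtain ⟨e, rfl | rfl⟩ := hD v hvD
    · rw [← hs, (key e).1, (key e).2]; ring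
    · rw [← ht, (key e).1, (key e).2]; ring

theorem exists_domainData_eq (D : Set G.V) (h : G.L2) :
    ∃ f f₁ u u₁ c, G.DomainData D f f₁ (f - h) u u₁ c := by
  classical
  have hI : ∀ e, ∃ w w₁ : ℝ → ℂ, IsPrimitiveOn w w₁ (G.x (G.src e)) (G.x (G.tgt e)) ∧
      IsPrimitiveOn w₁ (fun x => w x - h e x) (G.x (G.src e)) (G.x (G.tgt e)) := fun e =>
    IsPrimitiveOn.exists_solution ((h e).intervalIntegrable (G.x_lt e).le) (G.x_lt e).le
  choose w w₁ hw hw₁ using hI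
  -- Isolated vertices carry no condition on the edge functions; counting them as Dirichlet vertices
  -- fixes their values and makes the system invertible.
  obtain ⟨D', hD'⟩ : ∃ D' : Set G.V, D' = D ∪ {v | ¬ ∃ e, G.src e = v ∨ G.tgt e = v} := ⟨_, rfl⟩
  obtain ⟨⟨α, β, c⟩, hp⟩ := vertexConditions_surjective (G := G) (D := D')
    (fun v hv => by
      by_contra hn
      exact hv (hD' ▸ Or.inr hn))
    -- The target is minus the defects of the particular solution `w`: its endpoint values and,
    -- outside `D'`, its Kirchhoff sums. On `D'` it is zero because `c` is the full vertex value.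
    (fun e => -w e (G.x (G.src e)), fun e => -w e (G.x (G.tgt e)),
      fun v => if v ∈ D' then 0 else
        (∑ e with G.tgt e = v, w₁ e (G.x v)) - ∑ e with G.src e = v, w₁ e (G.x v))
  have hv := fun v => congrFun (congrArg (fun q => q.2.2) hp) v
  have hc : ∀ v ∈ D', c v = 0 := fun v hvD => by
    have := hv v
    simpa [vertexConditions, hvD] using this
  obtain ⟨f, f₁, hf⟩ := exists_domainData (D := D) (h := h) (c := c)
    (u := fun e x => w e x + (α e * Complex.exp x + β e * Complex.exp (-x)))
    (u₁ := fun e x => w₁ e x + (α e * Complex.exp x - β e * Complex.exp (-x)))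
    (fun e => (hw e).add (IsPrimitiveOn.exp_add_exp _ _))
    (fun e => ((hw₁ e).add (IsPrimitiveOn.exp_sub_exp _ _)).congr_ae
      (Filter.Eventually.of_forall fun x => by ring) (G.x_lt e).le)
    (fun e => by
      have h1 : α e * Complex.exp (G.x (G.src e)) + β e * Complex.exp (-G.x (G.src e))
        - c (G.src e) = -w e (G.x (G.src e)) := congrFun (congrArg Prod.fst hp) e
      linear_combination h1)
    (fun e => by
      have h1 : α e * Complex.exp (G.x (G.tgt e)) + β e * Complex.exp (-G.x (G.tgt e))
        - c (G.tgt e) = -w e (G.x (G.tgt e)) := congrFun (congrArg (fun q => q.2.1) hp) e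
      linear_combination h1)
    (fun v hvD => hc v (hD' ▸ Or.inl hvD))
    (fun v hvD => by
      -- A vertex in `D'` but not in `D` is isolated, so both Kirchhoff sums are empty.
      by_cases hvD' : v ∈ D'
      · have hn : ∀ e, ¬ (G.src e = v ∨ G.tgt e = v) := by
          rw [hD'] at hvD'
          exact not_exists.1 (hvD'.resolve_left hvD)
        rw [Finset.sum_eq_zero fun e he => absurd (Or.inl (Finset.mem_filter.1 he).2) (hn e),
          Finset.sum_eq_zero fun e he => absurd (Or.inr (Finset.mem_filter.1 he).2) (hn e),
          sub_zero]
      · have h1 := hv v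
        simp only [vertexConditions, LinearMap.coe_mk, AddHom.coe_mk, if_neg hvD'] at h1
        rw [Finset.sum_add_distrib, Finset.sum_add_distrib]
        linear_combination h1)
  exact ⟨f, f₁, _, _, c, hf⟩

/-- The Laplacian of a finite metric graph, with Dirichlet conditions at some vertices and
Kirchhoff conditions at the others, is densely defined and self-adjoint. -/
theorem dense_and_isSelfAdjoint_laplacian (G : QuantumGraph) (D : Set G.V) :
    Dense ((G.laplacian D).domain : Set G.L2) ∧ IsSelfAdjoint (G.laplacian D) := by
  refine LinearPMap.dense_and_isSelfAdjoint_of_surjective isFormalAdjoint_laplacian fun h => ?_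
  obtain ⟨f, f₁, u, u₁, c, hf⟩ := exists_domainData_eq D h
  have hm : f ∈ G.laplacianDomain D := ⟨_, _, _, _, _, hf⟩
  refine ⟨⟨f, hm⟩, ?_⟩
  rw [laplacian_apply hm hf]
  exact (neg_add_eq_iff_eq_add.2 (by abel))

end QuantumGraph

theorem mainTheorem10 (C : PlateConfiguration) (n : ℕ) :
    Dense ((C.B n).domain : Set (C.F n).L2) ∧ IsSelfAdjoint (C.B n) :=
  (C.F n).dense_and_isSelfAdjoint_laplacian (C.conducting n)
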